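/- Let $\mathbb K$ be a field, let $X_i\subset\mathbb P^{r_i}_{\mathbb K}$ ($1\le i\le m$) and $Y\subset\mathbb P^s_{\mathbb K}$ be integral projective varieties with homogeneous coordinate rings $A_i=\mathbb K[\mathbf x_i]/\mathfrak a_i$, $\mathbf x_i=(x_{i,0},\dots,x_{i,r_i})$, and $S=\mathbb K[\mathbf y]/\mathfrak b$, $\mathbf y=(y_0,\dots,y_s)$. Assume that $X=X_1\times_{\mathbb K}\cdots\times_{\mathbb K}X_m$ is integral, i.e. that its multi-homogeneous coordinate ring $R=A_1\otimes_{\mathbb K}\cdots\otimes_{\mathbb K}A_m=\mathbb K[\mathbf x]/(\mathfrak a_1,\dots,\mathfrak a_m)$ is an integral domain. Let $\mathcal F: X_1\times\cdots\times X_m\dashrightarrow Y$ be a dominant rational map given by multi-homogeneous elements $f_0,\dots,f_s\in R$ of the same multi-degree, not all zero. We say that $\mathcal F$ is birational if it has an inverse rational map $\mathcal G:Y\dashrightarrow X_1\times\cdots\times X_m$, where each component $Y\dashrightarrow X_i$ is given by $r_i+1$ forms of $S$ of the same degree, not all zero. Let $I=(f_0,\dots,f_s)\subset R$, let $\mathcal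 Q\subset\mathbb K[\mathbf x,\mathbf y]$ be the ideal of defining equations of the Rees algebra of $I$, that is, the kernel of $\mathbb K[\mathbf x,\mathbf y]\to R[It]\subset R[t]$, $x_{i,j}\mapsto x_{i,j}$, $y_j\mapsto f_jt$. For each $i$ let $h_{i,1},\dots,h_{i,k_i}$ be a minimal set of ($\mathbf y$-homogeneous) generators of the $\mathbb K[\mathbf y]$-module of those elements of $\mathcal Q$ which have degree $1$ in $\mathbf x_i$ and degree $0$ in $\mathbf x_{i'}$ for $i'\ne i$, the degree in $\mathbf y$ being arbitrary. Let $\psi_i=\left(\partial h_{i,a}/\partial x_{i,j}\right)_{1\le a\le k_i,\;0\le j\le r_i}$, a $k_i\times(r_i+1)$ matrix with entries in $\mathbb K[\mathbf y]$ (the $\mathbf x_i$-partial Jacobian dual matrix), and let $\psi$ be the block diagonal matrix with diagonal blocks $\psi_1,\dots,\psi_m$ (the full Jacobian dual matrix). **Theorem (multi-graded Jacobian dual criterion).** The following conditions are equivalent: 1. $\mathcal F$ is birational. 2. $\operatorname{rank}_S(\psi_i\otimes_{\mathbb K[\mathbf y]}S)=r_i$ for each $i=1,\dots,m$. 3. $\operatorname{rank}_S(\psi\otimes_{\mathbb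 K[\mathbf y]}S)=r_1+\cdots+r_m$. In addition, if $\mathcal F$ is birational, then for each $i$ the matrix $\psi_i$ has an $r_i\times(r_i+1)$ submatrix whose rank over $S$ is $r_i$; and for every choice of such submatrices $M_i$ of $\psi_i$, $1\le i\le m$, the inverse of $\mathcal F$ (unique as a rational map) is the map $\mathcal G:Y\dashrightarrow X_1\times\cdots\times X_m$ whose component $Y\dashrightarrow X_i$ is given by the signed ordered maximal minors $\Delta_j=(-1)^j\det\big(M_i\text{ without column }j\big)$, $0\le j\le r_i$, of $M_i$. -/

import Mathlib

noncomputable section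

namespace MultiRat

open MvPolynomial

attribute [local instance] MvPolynomial.gradedAlgebra

variable {K : Type*} [Field K]

/-- An integral closed subvariety of `ℙⁿ` over `K`, given by its homogeneous prime ideal
(which does not contain the irrelevant ideal). -/
structure ProjVariety (K : Type*) [Field K] (n : ℕ) where
  ideal : Ideal (MvPolynomial (Fin (n + 1)) K)
  isPrime : ideal.IsPrime
  isHomogeneous : ideal.IsHomogeneous (homogeneousSubmodule (Fin (n + 1)) K)
  relevant : ∃ j, (X j : MvPolynomial (Fin (n + 1)) K) ∉ ideal

/-- The homogeneous coordinate ring of a projective variety. -/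
abbrev ProjVariety.coordRing {n : ℕ} (Y : ProjVariety K n) : Type _ :=
  MvPolynomial (Fin (n + 1)) K ⧸ Y.ideal

/-- The index set of the variables `x_{i,j}`, `1 ≤ i ≤ m`, `0 ≤ j ≤ r i`. -/
abbrev Idx {m : ℕ} (r : Fin m → ℕ) : Type := Σ i : Fin m, Fin (r i + 1)

/-- The multi-grading on polynomials in the `x_{i,j}`: `x_{i,j}` has degree the `i`-th unit vector. -/
def xWeight {m : ℕ} (r : Fin m → ℕ) : Idx r → (Fin m → ℕ) :=
  fun p => Pi.single p.1 1

/-- The ideal `(𝔞₁, …, 𝔞ₘ)` of `K[x]` generated by the ideals `𝔞ᵢ ⊆ K[xᵢ]` of the factors. -/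
def prodIdeal {m : ℕ} {r : Fin m → ℕ} (V : ∀ i, ProjVariety K (r i)) :
    Ideal (MvPolynomial (Idx r) K) :=
  ⨆ i, (V i).ideal.map
    (rename (fun j => (⟨i, j⟩ : Idx r)) :
      MvPolynomial (Fin (r i + 1)) K →ₐ[K] MvPolynomial (Idx r) K)

/-- The multi-homogeneous coordinate ring `R = A₁ ⊗ ⋯ ⊗ Aₘ = K[x] / (𝔞₁, …, 𝔞ₘ)`
of `X₁ × ⋯ × Xₘ`. -/
abbrev prodRing {m : ℕ} {r : Fin m → ℕ} (V : ∀ i, ProjVariety K (r i)) : Type _ :=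
  MvPolynomial (Idx r) K ⧸ prodIdeal V

/-- Two tuples `u`, `v` are both nonzero modulo `P` and are proportional modulo `P`. For a prime
ideal `P` this says that they are homogeneous coordinates of the same point over the
fraction field of `A ⧸ P`; for tuples of forms in the coordinate ring of an integral variety it
says that they define the same rational map. -/
def SamePoint {A κ : Type*} [CommRing A] (P : Ideal A) (u v : κ → A) : Prop :=
  (∃ j, u j ∉ P) ∧ (∃ j, v j ∉ P) ∧ ∀ a b, u a * v b - u b * v a ∈ P

/-- A rational map `X₁ × ⋯ × Xₘ ⇢ Y ⊆ ℙˢ`, given by forms of the same multi-degree (polynomials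
representing elements of `R`) which are not all zero in `R` and at which the equations of `Y`
vanish. -/
structure RatMap {m : ℕ} {r : Fin m → ℕ} {s : ℕ} (V : ∀ i, ProjVariety K (r i))
    (Y : ProjVariety K s) where
  form : Fin (s + 1) → MvPolynomial (Idx r) K
  deg : Fin m → ℕ
  isHomogeneous : ∀ j, IsWeightedHomogeneous (xWeight r) (form j) deg
  ne_zero : ∃ j, form j ∉ prodIdeal V
  maps_to : ∀ h ∈ Y.ideal, aeval form h ∈ prodIdeal V

/-- A tuple of rational maps `Y ⇢ Xᵢ ⊆ ℙ^{rᵢ}`, `1 ≤ i ≤ m`, each given by `rᵢ + 1` forms of the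
same degree (polynomials representing elements of the coordinate ring of `Y`), not all
zero on `Y`, at which the equations of `Xᵢ` vanish. -/
structure RatMapTuple {m : ℕ} {r : Fin m → ℕ} {s : ℕ} (Y : ProjVariety K s)
    (V : ∀ i, ProjVariety K (r i)) where
  form : ∀ i, Fin (r i + 1) → MvPolynomial (Fin (s + 1)) K
  deg : Fin m → ℕ
  isHomogeneous : ∀ i j, (form i j).IsHomogeneous (deg i)
  ne_zero : ∀ i, ∃ j, form i j ∉ Y.ideal
  maps_to : ∀ i, ∀ h ∈ (V i).ideal, aeval (form i) h ∈ Y.ideal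

section

variable {m : ℕ} {r : Fin m → ℕ} {s : ℕ} {V : ∀ i, ProjVariety K (r i)} {Y : ProjVariety K s}

/-- The image is dense in `Y`: a form vanishing on the image vanishes on `Y`. -/
def RatMap.IsDominant (F : RatMap V Y) : Prop :=
  ∀ (n : ℕ) (h : MvPolynomial (Fin (s + 1)) K), h.IsHomogeneous n →
    aeval F.form h ∈ prodIdeal V → h ∈ Y.ideal

/-- Two tuples of forms define the same rational map `Y ⇢ X₁ × ⋯ × Xₘ`. -/
def RatMapTuple.Same (G G' : RatMapTuple Y V) : Prop :=
  ∀ i, SamePoint Y.ideal (G.form i) (G'.form i)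

/-- `G` is inverse to `F`: both composites are defined, `G ∘ F` is the identity of
`X₁ × ⋯ × Xₘ` and `F ∘ G` is the identity of `Y`, as rational maps. -/
def IsInverse (F : RatMap V Y) (G : RatMapTuple Y V) : Prop :=
  (∀ i, SamePoint (prodIdeal V) (fun j => aeval F.form (G.form i j))
      (fun j => (X ⟨i, j⟩ : MvPolynomial (Idx r) K))) ∧
    SamePoint Y.ideal (fun j => aeval (fun p : Idx r => G.form p.1 p.2) (F.form j))
      (fun j => (X j : MvPolynomial (Fin (s + 1)) K))

/-- `F` is birational: it is dominant and has an inverse rational map. -/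
def RatMap.IsBirational (F : RatMap V Y) : Prop :=
  F.IsDominant ∧ ∃ G : RatMapTuple Y V, IsInverse F G

/-- The presentation `K[x, y] → R[I t] ⊆ R[t]`, `x ↦ x`, `y_j ↦ f_j t`, of the Rees algebra of the
ideal `I = (f₀, …, f_s)` of `R`. Here `K[x, y]` is written as `K[y][x]`. -/
def reesMap (F : RatMap V Y) :
    MvPolynomial (Idx r) (MvPolynomial (Fin (s + 1)) K) →+* Polynomial (prodRing V) :=
  eval₂Hom
    (aeval (R := K) (fun j : Fin (s + 1) =>
      Polynomial.C (Ideal.Quotient.mk (prodIdeal V) (F.form j)) * Polynomial.X)).toRingHom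
    (fun p => Polynomial.C (Ideal.Quotient.mk (prodIdeal V) (X p)))

/-- The defining equations, in `K[x, y]`, of the Rees algebra of `I`. -/
def reesIdeal (F : RatMap V Y) : Ideal (MvPolynomial (Idx r) (MvPolynomial (Fin (s + 1)) K)) :=
  RingHom.ker (reesMap F)

/-- The `K[y]`-module of the defining equations of the Rees algebra of multi-degree
`(0, …, 1, …, 0, *)`, with `1` in position `i`. -/
def reesPart (F : RatMap V Y) (i : Fin m) :
    Submodule (MvPolynomial (Fin (s + 1)) K)
      (MvPolynomial (Idx r) (MvPolynomial (Fin (s + 1)) K)) :=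
  (reesIdeal F).restrictScalars (MvPolynomial (Fin (s + 1)) K) ⊓
    weightedHomogeneousSubmodule (MvPolynomial (Fin (s + 1)) K) (xWeight r) (Pi.single i 1)

/-- `h₁, …, h_k` is a minimal set of generators, homogeneous in `y`, of the `K[y]`-module of the
defining equations of multi-degree `(0, …, 1, …, 0, *)`. -/
structure IsMinGenerators (F : RatMap V Y) (i : Fin m) {k : ℕ}
    (h : Fin k → MvPolynomial (Idx r) (MvPolynomial (Fin (s + 1)) K)) : Prop where
  span_eq : Submodule.span (MvPolynomial (Fin (s + 1)) K) (Set.range h) = reesPart F i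
  minimal : ∀ a, h a ∉ Submodule.span (MvPolynomial (Fin (s + 1)) K) (h '' {a}ᶜ)
  isHomogeneous : ∀ a, ∃ e : ℕ, ∀ d, (coeff d (h a)).IsHomogeneous e

end

/-- The Jacobian matrix `∂h_a / ∂x_{i,j}` of polynomials `h₁, …, h_k ∈ K[y][x]` which are linear
forms in `xᵢ`; the derivatives are then constant in `x`, and are read as elements of `K[y]`. -/
def jacobianDual {m s : ℕ} {r : Fin m → ℕ} (i : Fin m) {k : ℕ}
    (h : Fin k → MvPolynomial (Idx r) (MvPolynomial (Fin (s + 1)) K)) :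
    Matrix (Fin k) (Fin (r i + 1)) (MvPolynomial (Fin (s + 1)) K) :=
  Matrix.of fun a j => constantCoeff (pderiv (⟨i, j⟩ : Idx r) (h a))

/-- The full Jacobian dual matrix, with the blocks `ψ₁, …, ψₘ` in the main diagonal. -/
def fullJacobianDual {m s : ℕ} {r k : Fin m → ℕ}
    (h : ∀ i, Fin (k i) → MvPolynomial (Idx r) (MvPolynomial (Fin (s + 1)) K)) :
    Matrix (Σ i, Fin (k i)) (Idx r) (MvPolynomial (Fin (s + 1)) K) :=
  Matrix.blockDiagonal' fun i => jacobianDual i (h i)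

/-- The rank over the coordinate ring `S = K[y] / 𝔟` of `Y` of a matrix with entries in `K[y]`. -/
def rankOver {s : ℕ} (Y : ProjVariety K s) {α β : Type*} [Fintype β]
    (A : Matrix α β (MvPolynomial (Fin (s + 1)) K)) : ℕ :=
  (A.map (Ideal.Quotient.mk Y.ideal)).rank

/-- The signed ordered maximal minors of an `n × (n + 1)` matrix: the `j`-th one is `(-1)ʲ` times
the determinant of the matrix with column `j` deleted. -/
def signedMinors {A : Type*} [CommRing A] {n : ℕ} (M : Matrix (Fin n) (Fin (n + 1)) A) :
    Fin (n + 1) → A :=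
  fun j => (-1) ^ (j : ℕ) * (M.submatrix id j.succAbove).det

end MultiRat

end

/-! Everything is compared inside the domain `R[t]`. Dominance makes `y_j ↦ f_j t` an embedding of
`S` into `R[t]`, and a form linear in `xᵢ` with coefficients in `K[y]` is a Rees equation exactly
when its image, evaluated at the coordinate vector of `Xᵢ`, is zero. Hence `ψᵢ` annihilates that
nonzero vector and its rank is at most `rᵢ` (`IsMinGenerators.rankOver_le`). If `G` is an inverse
with components `g`, the forms `g_a x_b - g_b x_a` are Rees equations, so the kernel of `ψᵢ` over
`Frac S` lies in the line of `g` and the rank is at least `rᵢ` (`le_rankOver_of_isInverse`).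
Conversely, an `rᵢ × (rᵢ + 1)` submatrix of rank `rᵢ` has minors that are not all zero and, by
Cramer's rule, are proportional to the coordinates of `Xᵢ`. Such forms constitute an inverse
(`IsInverseForms.isInverse`), and any two inverses agree (`IsInverse.same`). The full matrix is
handled by additivity of rank over diagonal blocks together with the bounds `≤ rᵢ`. -/

noncomputable section

namespace MultiRat

open MvPolynomial Matrix

/-! ### Ranks and minors of matrices over a domain -/

section MatrixRank

/-- The rank of a matrix over a domain is its rank over the fraction field. -/
theorem rank_map_fractionRing {S : Type*} [CommRing S] [IsDomain S] {α β : Type*} [Finite α]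
    [Fintype β] (A : Matrix α β S) :
    (A.map (algebraMap S (FractionRing S))).rank = A.rank := by
  let f : (α → S) →ₗ[S] (α → FractionRing S) :=
    LinearMap.pi fun i => Algebra.linearMap S (FractionRing S) ∘ₗ LinearMap.proj i
  have : IsLocalizedModule (nonZeroDivisors S) f := IsLocalizedModule.pi _ _
  have h2 : Submodule.localized' (FractionRing S) (nonZeroDivisors S) f
      (Submodule.span S (Set.range A.col)) =
      Submodule.span (FractionRing S)
        (Set.range (A.map (algebraMap S (FractionRing S))).col) := by
    rw [Submodule.localized'_span, ← Set.range_comp]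
    rfl
  rw [rank_eq_finrank_span_cols, rank_eq_finrank_span_cols, ← h2,
    IsFractionRing.finrank_right_eq S]
  exact IsLocalizedModule.finrank_eq (nonZeroDivisors S)
    (Submodule.toLocalized' (FractionRing S) (nonZeroDivisors S) f _) le_rfl

/-- A basis of the row space can be chosen among the rows; listing their indices increasingly gives
`ρ`. -/
theorem exists_submatrix_rank_eq_of_field {L : Type*} [Field L] {k n : ℕ} {β : Type*} [Fintype β]
    (A : Matrix (Fin k) β L) (hA : A.rank = n) :
    ∃ ρ : Fin n ↪o Fin k, (A.submatrix ρ id).rank = n := by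
  classical
  obtain ⟨κ, a, ha, hspan, hli⟩ := exists_linearIndependent' L A.row
  have : Finite κ := Finite.of_injective a ha
  have := Fintype.ofFinite κ
  have hc : (Finset.univ.image a).card = n := by
    rw [Finset.card_image_of_injective _ ha, Finset.card_univ, ← hA, rank_eq_finrank_span_row,
      ← hspan, finrank_span_eq_card hli]
  refine ⟨(Finset.univ.image a).orderEmbOfFin hc, ?_⟩
  refine Eq.trans ?_ hA
  rw [rank_eq_finrank_span_row, rank_eq_finrank_span_row, ← hspan]
  have h1 : (A.submatrix ((Finset.univ.image a).orderEmbOfFin hc) id).row =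
      A.row ∘ ((Finset.univ.image a).orderEmbOfFin hc) := rfl
  rw [h1, Set.range_comp, Finset.range_orderEmbOfFin, Finset.coe_image, Finset.coe_univ,
    Set.image_univ, ← Set.range_comp]

theorem exists_submatrix_rank_eq {S : Type*} [CommRing S] [IsDomain S] {k n : ℕ} {β : Type*}
    [Fintype β] (A : Matrix (Fin k) β S) (hA : A.rank = n) :
    ∃ ρ : Fin n ↪o Fin k, (A.submatrix ρ id).rank = n := by
  rw [← rank_map_fractionRing] at hA
  obtain ⟨ρ, hρ⟩ := exists_submatrix_rank_eq_of_field _ hA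
  exact ⟨ρ, by rwa [← rank_map_fractionRing, ← submatrix_map]⟩

theorem det_ne_zero_of_rank_eq {S : Type*} [CommRing S] [IsDomain S] {n : ℕ}
    (A : Matrix (Fin n) (Fin n) S) (hA : A.rank = n) : A.det ≠ 0 := by
  intro h0
  rw [← rank_map_fractionRing] at hA
  have h1 : (A.map (algebraMap S (FractionRing S))).det = 0 := by
    have := RingHom.map_det (algebraMap S (FractionRing S)) A
    rw [h0, map_zero] at this
    exact this.symm
  obtain ⟨v, hv, hv0⟩ := exists_mulVec_eq_zero_iff.2 h1
  have hk : LinearMap.ker (A.map (algebraMap S (FractionRing S))).mulVecLin ≠ ⊥ := by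
    intro hb
    exact hv ((Submodule.eq_bot_iff _).1 hb v hv0)
  have h2 := LinearMap.finrank_range_add_finrank_ker
    (A.map (algebraMap S (FractionRing S))).mulVecLin
  have h3 := Submodule.one_le_finrank_iff.2 hk
  rw [Module.finrank_fin_fun] at h2
  unfold Matrix.rank at hA
  omega

/-- Some `n` columns are independent over the fraction field. An increasing choice of `n` out of `n
+ 1` indices omits a single `j`, so it is `j.succAbove` and the `j`-th minor is nonzero. -/
theorem exists_signedMinors_ne_zero {S : Type*} [CommRing S] [IsDomain S] {n : ℕ}
    (M : Matrix (Fin n) (Fin (n + 1)) S) (hM : M.rank = n) : ∃ j, signedMinors M j ≠ 0 := by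
  have hT : (M.map (algebraMap S (FractionRing S)))ᵀ.rank = n := by
    rw [rank_transpose, rank_map_fractionRing, hM]
  obtain ⟨c, hc⟩ := exists_submatrix_rank_eq_of_field _ hT
  obtain ⟨j, hj⟩ : ∃ j, j ∉ Set.range c := by
    by_contra! h
    simpa using Fintype.card_le_of_surjective c h
  have hcj : ∃ j : Fin (n + 1), c = j.succAboveOrderEmb := by
    refine ⟨j, OrderEmbedding.range_inj.1 ?_⟩
    have : Set.range c ⊆ Set.range j.succAboveOrderEmb := by
      rintro _ ⟨i, rfl⟩
      change c i ∈ Set.range j.succAbove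
      rw [Fin.range_succAbove]
      exact fun h => hj ⟨i, h⟩
    refine Set.eq_of_subset_of_ncard_le this ?_ (Set.finite_range _)
    rw [Set.ncard_range_of_injective c.injective,
      Set.ncard_range_of_injective (Fin.succAboveOrderEmb j).injective]
  obtain ⟨j, rfl⟩ := hcj
  refine ⟨j, ?_⟩
  have h1 := det_ne_zero_of_rank_eq _ hc
  rw [← det_transpose] at h1
  have h2 : (algebraMap S (FractionRing S)) (M.submatrix id j.succAbove).det ≠ 0 := by
    rw [RingHom.map_det]
    exact h1
  have h3 : (M.submatrix id j.succAbove).det ≠ 0 := fun h => h2 (by rw [h, map_zero])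
  exact mul_ne_zero (pow_ne_zero _ (neg_ne_zero.2 one_ne_zero)) h3

/-- A nonzero vector annihilated by an `n × (n + 1)` matrix is proportional to the vector of its
signed maximal minors. -/
theorem signedMinors_proportional {D : Type*} [CommRing D] [IsDomain D] {n : ℕ}
    (M : Matrix (Fin n) (Fin (n + 1)) D) (x : Fin (n + 1) → D) (hx : M *ᵥ x = 0)
    (a b : Fin (n + 1)) : signedMinors M a * x b - signedMinors M b * x a = 0 := by
  by_cases hx0 : x = 0
  · simp [hx0]
  -- The row `w` is orthogonal to `x`, so putting it on top of `M` gives a singular square matrix;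
  -- expanding its determinant along `w` yields the relation.
  let w : Fin (n + 1) → D := Pi.single a (x b) - Pi.single b (x a)
  let N : Matrix (Fin (n + 1)) (Fin (n + 1)) D := Matrix.of (Fin.cons w M)
  have hN : N *ᵥ x = 0 := by
    ext i
    refine Fin.cases ?_ (fun i => ?_) i
    · change w ⬝ᵥ x = 0
      simp [w, sub_dotProduct, mul_comm]
    · exact congrFun hx i
  have hdet : N.det = 0 := exists_mulVec_eq_zero_iff.1 ⟨x, hx0, hN⟩
  rw [det_succ_row_zero] at hdet
  rw [← hdet]
  have : ∀ j : Fin (n + 1), (-1) ^ (j : ℕ) * N 0 j * (N.submatrix Fin.succ j.succAbove).det =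
      w j * signedMinors M j := by
    intro j
    have : N.submatrix Fin.succ j.succAbove = M.submatrix id j.succAbove := rfl
    rw [this, signedMinors]
    change (-1) ^ (j : ℕ) * w j * _ = _
    ring
  simp only [this]
  change _ = w ⬝ᵥ signedMinors M
  simp [w, sub_dotProduct, mul_comm]

theorem map_signedMinors {A B : Type*} [CommRing A] [CommRing B] (φ : A →+* B) {n : ℕ}
    (M : Matrix (Fin n) (Fin (n + 1)) A) (j : Fin (n + 1)) :
    φ (signedMinors M j) = signedMinors (M.map φ) j := by
  simp only [signedMinors, map_mul, map_pow, map_neg, map_one, RingHom.map_det]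
  rfl

/-- A matrix with `n + 1` columns which annihilates a nonzero vector over a larger domain has rank
at most `n`. -/
theorem rank_le_of_map_mulVec_eq_zero {S D : Type*} [CommRing S] [IsDomain S] [CommRing D]
    [IsDomain D] (φ : S →+* D) (hφ : Function.Injective φ) {k n : ℕ}
    (A : Matrix (Fin k) (Fin (n + 1)) S) (x : Fin (n + 1) → D) (hx0 : x ≠ 0)
    (hx : A.map φ *ᵥ x = 0) : A.rank ≤ n := by
  by_contra! hlt
  have hA : A.rank = n + 1 := le_antisymm A.rank_le_width hlt
  -- Full column rank would give a nonzero maximal minor, whose image under the injective `φ` must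
  -- vanish since the matrix kills `x`.
  obtain ⟨ρ, hρ⟩ := exists_submatrix_rank_eq A hA
  have h1 := det_ne_zero_of_rank_eq _ hρ
  have h2 : ((A.submatrix ρ id).map φ).det = 0 := by
    refine exists_mulVec_eq_zero_iff.1 ⟨x, hx0, ?_⟩
    ext i
    exact congrFun hx (ρ i)
  refine h1 (hφ ?_)
  rw [RingHom.map_det, map_zero]
  exact h2

/-- If the kernel of a matrix over the fraction field of `S` is contained in the line spanned by a
nonzero vector, then the rank of the matrix is at least the number of columns minus one. -/
theorem le_rank_of_ker_le_line {S : Type*} [CommRing S] [IsDomain S] {k n : ℕ}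
    (A : Matrix (Fin k) (Fin (n + 1)) S) (g : Fin (n + 1) → FractionRing S) (a : Fin (n + 1))
    (ha : g a ≠ 0)
    (hg : ∀ v, A.map (algebraMap S (FractionRing S)) *ᵥ v = 0 → ∀ b, g a * v b = g b * v a) :
    n ≤ A.rank := by
  have h2 := LinearMap.finrank_range_add_finrank_ker
    (A.map (algebraMap S (FractionRing S))).mulVecLin
  rw [Module.finrank_fin_fun] at h2
  have hle : LinearMap.ker (A.map (algebraMap S (FractionRing S))).mulVecLin ≤
      Submodule.span (FractionRing S) {g} := by
    intro v hv
    rw [Submodule.mem_span_singleton]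
    refine ⟨v a / g a, ?_⟩
    ext b
    have := hg v hv b
    simp only [Pi.smul_apply, smul_eq_mul]
    field_simp
    rw [mul_comm, ← this]
  have h3 := (Submodule.finrank_mono hle).trans (finrank_span_singleton (K := FractionRing S)
    (v := g) (fun h => ha (by rw [h]; rfl))).le
  rw [← rank_map_fractionRing]
  unfold Matrix.rank
  omega

theorem blockDiagonal'_mulVec_apply {L ι : Type*} [CommRing L] [Fintype ι] [DecidableEq ι]
    {α β : ι → Type*} [∀ i, Fintype (β i)] (A : ∀ i, Matrix (α i) (β i) L)
    (v : (Σ i, β i) → L) (p : Σ i, α i) :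
    (blockDiagonal' A *ᵥ v) p = (A p.1 *ᵥ fun j => v ⟨p.1, j⟩) p.2 := by
  obtain ⟨i, a⟩ := p
  simp only [mulVec, dotProduct, Fintype.sum_sigma]
  rw [Finset.sum_eq_single i]
  · simp
  · intro i' _ hne
    exact Finset.sum_eq_zero fun j _ => by rw [blockDiagonal'_apply_ne _ _ _ hne.symm, zero_mul]
  · simp

/-- Over the fraction field, the image of a block diagonal map is the product of the images of its
blocks. -/
theorem rank_blockDiagonal' {S ι : Type*} [CommRing S] [IsDomain S] [Fintype ι] [DecidableEq ι]
    {α β : ι → Type*} [∀ i, Finite (α i)] [∀ i, Fintype (β i)] (A : ∀ i, Matrix (α i) (β i) S) :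
    (blockDiagonal' A).rank = ∑ i, (A i).rank := by
  let L := FractionRing S
  have key : ∀ B : ∀ i, Matrix (α i) (β i) L, (blockDiagonal' B).rank = ∑ i, (B i).rank := by
    intro B
    unfold Matrix.rank
    rw [← Module.finrank_pi_fintype L]
    refine LinearEquiv.finrank_eq (LinearEquiv.ofBijective
      (LinearMap.pi fun i => LinearMap.codRestrict _
        ((LinearMap.funLeft L L (fun a : α i => (⟨i, a⟩ : Σ i, α i))).comp
          (Submodule.subtype _)) ?_) ⟨?_, ?_⟩)
    · rintro ⟨_, v, rfl⟩
      refine ⟨fun j => v ⟨i, j⟩, ?_⟩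
      ext a
      exact (blockDiagonal'_mulVec_apply B v ⟨i, a⟩).symm
    · intro u v huv
      ext ⟨i, a⟩
      exact congrFun (congrArg Subtype.val (congrFun huv i)) a
    · intro w
      choose v hv using fun i => (w i).2
      refine ⟨⟨blockDiagonal' B *ᵥ fun p => v p.1 p.2, ⟨_, rfl⟩⟩, ?_⟩
      funext i
      apply Subtype.ext
      rw [← hv i]
      ext a
      exact blockDiagonal'_mulVec_apply B _ ⟨i, a⟩
  rw [← rank_map_fractionRing, blockDiagonal'_map _ _ (map_zero _), key]
  exact Finset.sum_congr rfl fun i _ => rank_map_fractionRing (A i)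

end MatrixRank

attribute [local instance] MvPolynomial.gradedAlgebra

variable {K : Type*} [Field K]

/-! ### Homogeneous polynomials under scaling and substitution -/

section Homogeneity

/-- The character `χ` turns weights into scalars, which covers both the ordinary grading (powers of
one element) and the multi-grading (`powHom`). -/
theorem aeval_mul_of_isWeightedHomogeneous {σ M A : Type*} [AddCommMonoid M] [CommSemiring A]
    [Algebra K A] {w : σ → M} {d : M} {p : MvPolynomial σ K} (hp : IsWeightedHomogeneous w p d)
    (χ : Multiplicative M →* A) (c : σ → A) :
    aeval (fun t => χ (Multiplicative.ofAdd (w t)) * c t) p =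
      χ (Multiplicative.ofAdd d) * aeval c p := by
  rw [aeval_def, aeval_def, eval₂_eq, eval₂_eq, Finset.mul_sum]
  refine Finset.sum_congr rfl fun n hn => ?_
  have hw := hp (mem_support_iff.1 hn)
  rw [Finsupp.weight_apply, Finsupp.sum] at hw
  rw [← hw, ofAdd_sum, map_prod, mul_left_comm, ← Finset.prod_mul_distrib]
  simp only [mul_pow, ofAdd_nsmul, map_pow]

theorem isHomogeneous_aeval_of_isWeightedHomogeneous {σ τ M : Type*} [AddCommMonoid M]
    {w : σ → M} {d : M} {p : MvPolynomial σ K} (hp : IsWeightedHomogeneous w p d) (φ : M →+ ℕ)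
    (g : σ → MvPolynomial τ K) (hg : ∀ t, (g t).IsHomogeneous (φ (w t))) :
    (aeval g p).IsHomogeneous (φ d) := by
  rw [aeval_def, eval₂_eq]
  refine IsHomogeneous.sum _ _ _ fun n hn => ?_
  have hw := hp (mem_support_iff.1 hn)
  rw [Finsupp.weight_apply, Finsupp.sum] at hw
  rw [← hw, map_sum, ← zero_add (∑ _ ∈ _, _)]
  refine (isHomogeneous_C _ _).mul (IsHomogeneous.prod _ _ _ fun t _ => ?_)
  rw [map_nsmul, smul_eq_mul, mul_comm]
  exact (hg t).pow _

theorem aeval_mk_eq {σ τ : Type*} (I : Ideal (MvPolynomial τ K)) (g : σ → MvPolynomial τ K)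
    (p : MvPolynomial σ K) :
    aeval (fun j => Ideal.Quotient.mk I (g j)) p = Ideal.Quotient.mk I (aeval g p) :=
  (comp_aeval_apply (f := g) (Ideal.Quotient.mkₐ K I) p).symm

theorem aeval_C_mul_X_of_isHomogeneous {σ A : Type*} [CommRing A] [Algebra K A] {n : ℕ}
    {p : MvPolynomial σ K} (hp : p.IsHomogeneous n) (g : σ → A) :
    aeval (fun j => Polynomial.C (g j) * Polynomial.X) p =
      Polynomial.C (aeval g p) * Polynomial.X ^ n := by
  have h1 := aeval_mul_of_isWeightedHomogeneous hp
    (powersHom (Polynomial A) Polynomial.X) (fun j => Polynomial.C (g j))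
  have h2 : aeval (fun j => Polynomial.C (g j)) p = Polynomial.C (aeval g p) :=
    (comp_aeval_apply (f := g) (Polynomial.CAlgHom (R := K) (A := A)) p).symm
  rw [h2] at h1
  simp only [Pi.one_apply, powersHom_apply, toAdd_ofAdd, pow_one] at h1
  rw [mul_comm, ← h1]
  simp only [mul_comm]

theorem C_mul_X_pow_mul_C_sub {A : Type*} [CommRing A] (a b c d : A) (n : ℕ) :
    Polynomial.C a * Polynomial.X ^ n * Polynomial.C b -
      Polynomial.C c * Polynomial.X ^ n * Polynomial.C d =
      Polynomial.C (a * b - c * d) * Polynomial.X ^ n := by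
  simp only [Polynomial.C_sub, Polynomial.C_mul]
  ring

theorem ProjVariety.constantCoeff_eq_zero {n : ℕ} (W : ProjVariety K n)
    {p : MvPolynomial (Fin (n + 1)) K} (hp : p ∈ W.ideal) : constantCoeff p = 0 := by
  by_contra h0
  have h1 := homogeneousComponent_mem_of_mem W.isHomogeneous hp 0
  rw [homogeneousComponent_zero] at h1
  refine W.isPrime.ne_top (Ideal.eq_top_of_isUnit_mem _ h1 ?_)
  exact (isUnit_iff_ne_zero.2 h0).map C

/-- Each Leibniz term uses every row once, so the degree does not depend on the deleted column. -/
theorem isHomogeneous_signedMinors {A τ : Type*} [CommRing A] {n : ℕ}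
    (M : Matrix (Fin n) (Fin (n + 1)) (MvPolynomial τ A)) (e : Fin n → ℕ)
    (hM : ∀ a j, (M a j).IsHomogeneous (e a)) (j : Fin (n + 1)) :
    (signedMinors M j).IsHomogeneous (∑ a, e a) := by
  have hdet : (M.submatrix id j.succAbove).det.IsHomogeneous (∑ a, e a) := by
    rw [det_apply']
    refine IsHomogeneous.sum _ _ _ fun σ _ => ?_
    have h1 : (∏ i, M.submatrix id j.succAbove (σ i) i).IsHomogeneous (∑ a, e a) := by
      rw [← Equiv.sum_comp σ e]
      exact IsHomogeneous.prod _ _ _ fun i _ => hM _ _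
    rcases Int.units_eq_one_or (Equiv.Perm.sign σ) with h | h
    · simpa [h] using h1
    · simpa [h] using h1.neg
  rcases neg_one_pow_eq_or (MvPolynomial τ A) (j : ℕ) with h | h
  · simpa [signedMinors, h] using hdet
  · simpa [signedMinors, h] using hdet.neg

end Homogeneity

/-! ### The factors inside the product ring -/

section Product

variable {m : ℕ} {r : Fin m → ℕ} (V : ∀ i, ProjVariety K (r i))

theorem rename_mem_prodIdeal (i : Fin m) {p : MvPolynomial (Fin (r i + 1)) K}
    (hp : p ∈ (V i).ideal) :
    rename (fun j => (⟨i, j⟩ : Idx r)) p ∈ prodIdeal V :=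
  le_iSup (fun i => (V i).ideal.map
    (rename (fun j => (⟨i, j⟩ : Idx r)) :
      MvPolynomial (Fin (r i + 1)) K →ₐ[K] MvPolynomial (Idx r) K)) i
    (Ideal.mem_map_of_mem _ hp)

/-- The projection `K[x] → K[xᵢ]` which sends all other variables to zero. -/
def factorProj (i : Fin m) : MvPolynomial (Idx r) K →ₐ[K] MvPolynomial (Fin (r i + 1)) K :=
  aeval fun p => if hp : p.1 = i then X (hp ▸ p.2) else 0

/-- This retraction shows that a coordinate of `Xᵢ` outside `𝔞ᵢ` stays nonzero in `R`. Equations of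
the other factors are evaluated at zero, where they vanish because a proper homogeneous ideal
contains no nonzero constant. -/
theorem factorProj_mem (i : Fin m) {p : MvPolynomial (Idx r) K} (hp : p ∈ prodIdeal V) :
    factorProj i p ∈ (V i).ideal := by
  suffices prodIdeal V ≤ (V i).ideal.comap (factorProj i).toRingHom from this hp
  refine iSup_le fun i' => Ideal.map_le_iff_le_comap.2 fun q hq => ?_
  change factorProj i (rename _ q) ∈ (V i).ideal
  rw [factorProj, aeval_rename]
  by_cases hi : i' = i
  · subst hi
    have : ((fun p : Idx r => if hp : p.1 = i' then
        (X (hp ▸ p.2) : MvPolynomial (Fin (r i' + 1)) K) else 0) ∘ fun j => (⟨i', j⟩ : Idx r)) =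
        X := by
      funext j
      simp
    rw [this, aeval_X_left_apply]
    exact hq
  · have : ((fun p : Idx r => if hp : p.1 = i then
        (X (hp ▸ p.2) : MvPolynomial (Fin (r i + 1)) K) else 0) ∘ fun j => (⟨i', j⟩ : Idx r)) =
        fun _ => 0 := by
      funext j
      simp [hi]
    rw [this, aeval_zero', (V i').constantCoeff_eq_zero hq, map_zero]
    exact zero_mem _

theorem exists_X_notMem_prodIdeal (i : Fin m) :
    ∃ j, (X ⟨i, j⟩ : MvPolynomial (Idx r) K) ∉ prodIdeal V := by
  obtain ⟨j, hj⟩ := (V i).relevant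
  refine ⟨j, fun h => hj ?_⟩
  have := factorProj_mem V i h
  simpa [factorProj] using this

end Product

/-! ### Linear Rees equations and the rank bounds -/

section Rees

variable {m : ℕ} {r : Fin m → ℕ} {s : ℕ} {V : ∀ i, ProjVariety K (r i)} {Y : ProjVariety K s}

theorem RatMap.IsDominant.mem_iff {F : RatMap V Y} (hF : F.IsDominant) {n : ℕ}
    {p : MvPolynomial (Fin (s + 1)) K} (hp : p.IsHomogeneous n) :
    p ∈ Y.ideal ↔ aeval F.form p ∈ prodIdeal V :=
  ⟨F.maps_to p, hF n p hp⟩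

/-- The homomorphism `K[y] → R[t]`, `y_j ↦ f_j t`. -/
def reesCoeff (F : RatMap V Y) : MvPolynomial (Fin (s + 1)) K →+* Polynomial (prodRing V) :=
  (aeval (R := K) (fun j : Fin (s + 1) =>
    Polynomial.C (Ideal.Quotient.mk (prodIdeal V) (F.form j)) * Polynomial.X)).toRingHom

theorem reesCoeff_of_isHomogeneous (F : RatMap V Y) {n : ℕ} {p : MvPolynomial (Fin (s + 1)) K}
    (hp : p.IsHomogeneous n) :
    reesCoeff F p =
      Polynomial.C (Ideal.Quotient.mk (prodIdeal V) (aeval F.form p)) * Polynomial.X ^ n := by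
  have h1 := aeval_C_mul_X_of_isHomogeneous hp
    (fun j => Ideal.Quotient.mk (prodIdeal V) (F.form j))
  have h2 : aeval (fun j => Ideal.Quotient.mk (prodIdeal V) (F.form j)) p =
      Ideal.Quotient.mk (prodIdeal V) (aeval F.form p) := aeval_mk_eq _ _ _
  rw [h2] at h1
  exact h1

/-- The power of `t` records the degree in `y`, so vanishing splits into homogeneous components, to
which dominance applies. -/
theorem reesCoeff_eq_zero_iff {F : RatMap V Y} (hF : F.IsDominant)
    (p : MvPolynomial (Fin (s + 1)) K) : reesCoeff F p = 0 ↔ p ∈ Y.ideal := by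
  have hsum : reesCoeff F p = ∑ n ∈ Finset.range (p.totalDegree + 1),
      Polynomial.C (Ideal.Quotient.mk (prodIdeal V) (aeval F.form (homogeneousComponent n p))) *
        Polynomial.X ^ n := by
    conv_lhs => rw [← sum_homogeneousComponent p, map_sum]
    exact Finset.sum_congr rfl fun n _ =>
      reesCoeff_of_isHomogeneous F (homogeneousComponent_isHomogeneous n p)
  constructor
  · intro h0
    rw [mem_iff_homogeneousComponent_mem Y.isHomogeneous]
    intro n
    rw [hF.mem_iff (homogeneousComponent_isHomogeneous n p)]
    by_cases hn : n ∈ Finset.range (p.totalDegree + 1)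
    · have h1 := congrArg (fun q => Polynomial.coeff q n) (hsum.symm.trans h0)
      simp only [Polynomial.finsetSum_coeff, Polynomial.coeff_C_mul_X_pow,
        Polynomial.coeff_zero] at h1
      rw [Finset.sum_ite_eq, if_pos hn] at h1
      exact Ideal.Quotient.eq_zero_iff_mem.1 h1
    · rw [homogeneousComponent_eq_zero n p (by simpa using hn), map_zero]
      exact zero_mem _
  · intro hp
    rw [hsum]
    refine Finset.sum_eq_zero fun n _ => ?_
    have := F.maps_to _ (homogeneousComponent_mem_of_mem Y.isHomogeneous hp n)
    rw [Ideal.Quotient.eq_zero_iff_mem.2 this, map_zero, zero_mul]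

/-- The embedding `S = K[y] / 𝔟 → R[t]`, `y_j ↦ f_j t`, for a dominant rational map. -/
def reesEmb {F : RatMap V Y} (hF : F.IsDominant) : Y.coordRing →+* Polynomial (prodRing V) :=
  Ideal.Quotient.lift Y.ideal (reesCoeff F) fun p hp => (reesCoeff_eq_zero_iff hF p).2 hp

theorem reesEmb_injective {F : RatMap V Y} (hF : F.IsDominant) :
    Function.Injective (reesEmb hF) := by
  rw [injective_iff_map_eq_zero]
  intro p hp
  obtain ⟨p, rfl⟩ := Ideal.Quotient.mk_surjective p
  exact Ideal.Quotient.eq_zero_iff_mem.2 ((reesCoeff_eq_zero_iff hF p).1 hp)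

theorem map_mk_map_reesEmb {F : RatMap V Y} (hF : F.IsDominant) {α β : Type*}
    (A : Matrix α β (MvPolynomial (Fin (s + 1)) K)) :
    (A.map (Ideal.Quotient.mk Y.ideal)).map (reesEmb hF) = A.map (reesCoeff F) := rfl

/-- The linear form in the variables `xᵢ` with the given coefficients. -/
def linForm (i : Fin m) (c : Fin (r i + 1) → MvPolynomial (Fin (s + 1)) K) :
    MvPolynomial (Idx r) (MvPolynomial (Fin (s + 1)) K) :=
  ∑ j, C (c j) * X ⟨i, j⟩

/-- The coefficient of `x_{i,j}`. -/
def linCoeff (i : Fin m) (h : MvPolynomial (Idx r) (MvPolynomial (Fin (s + 1)) K))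
    (j : Fin (r i + 1)) : MvPolynomial (Fin (s + 1)) K :=
  constantCoeff (pderiv (⟨i, j⟩ : Idx r) h)

theorem linCoeff_eq_coeff (i : Fin m) (h : MvPolynomial (Idx r) (MvPolynomial (Fin (s + 1)) K))
    (j : Fin (r i + 1)) : linCoeff i h j = coeff (Finsupp.single ⟨i, j⟩ 1) h := by
  rw [linCoeff, constantCoeff_eq, coeff_pderiv]
  simp

theorem linCoeff_linForm (i : Fin m) (c : Fin (r i + 1) → MvPolynomial (Fin (s + 1)) K)
    (j : Fin (r i + 1)) : linCoeff i (linForm i c) j = c j := by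
  classical
  simp [linCoeff, linForm, pderiv_X, Pi.single_apply]

theorem exists_eq_single_of_weight {i : Fin m} {d : Idx r →₀ ℕ}
    (hd : Finsupp.weight (xWeight r) d = Pi.single i 1) :
    ∃ j, d = Finsupp.single ⟨i, j⟩ 1 := by
  have hdeg : ∑ p ∈ d.support, d p = 1 := by
    -- Summing the multi-degree over all factors gives the total degree, here 1.
    have := congrArg (fun f : Fin m → ℕ => ∑ i', f i') hd
    simp only [Finsupp.weight_apply, Finsupp.sum, Finset.sum_apply, Pi.smul_apply] at this
    rw [Finset.sum_comm] at this
    simpa [xWeight, Pi.single_apply] using this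
  obtain ⟨p, rfl⟩ := (Finsupp.sum_eq_one_iff d).1 hdeg
  obtain ⟨i', j⟩ := p
  have h1 : (Pi.single i' 1 : Fin m → ℕ) = Pi.single i 1 := by
    simpa [Finsupp.weight_apply, xWeight] using hd
  have h2 : i' = i := by
    by_contra hne
    have := congrFun h1 i'
    rw [Pi.single_eq_same, Pi.single_eq_of_ne hne] at this
    exact one_ne_zero this
  subst h2
  exact ⟨j, rfl⟩

theorem eq_linForm_of_isWeightedHomogeneous {i : Fin m}
    {h : MvPolynomial (Idx r) (MvPolynomial (Fin (s + 1)) K)}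
    (hh : IsWeightedHomogeneous (xWeight r) h (Pi.single i 1)) :
    h = linForm i (linCoeff i h) := by
  classical
  ext1 d
  by_cases hd : ∃ j, d = Finsupp.single ⟨i, j⟩ 1
  · obtain ⟨j, rfl⟩ := hd
    rw [← linCoeff_eq_coeff, ← linCoeff_eq_coeff, linCoeff_linForm]
  · have h1 : coeff d h = 0 := by
      by_contra hne
      exact hd (exists_eq_single_of_weight (hh hne))
    rw [h1, linForm, coeff_sum]
    symm
    refine Finset.sum_eq_zero fun j _ => ?_
    rw [coeff_C_mul, coeff_X, if_neg fun h => hd ⟨j, h.symm⟩, mul_zero]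

theorem isWeightedHomogeneous_linForm (i : Fin m)
    (c : Fin (r i + 1) → MvPolynomial (Fin (s + 1)) K) :
    IsWeightedHomogeneous (xWeight r) (linForm i c) (Pi.single i 1) :=
  IsWeightedHomogeneous.sum _ _ _ fun j _ =>
    (isWeightedHomogeneous_X _ (xWeight r) (⟨i, j⟩ : Idx r)).C_mul _

/-- The coordinates `x_{i,j}` in `R[t]`. -/
def coordVec (V : ∀ i, ProjVariety K (r i)) (i : Fin m) :
    Fin (r i + 1) → Polynomial (prodRing V) :=
  fun j => Polynomial.C (Ideal.Quotient.mk (prodIdeal V) (X ⟨i, j⟩))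

theorem coordVec_ne_zero (V : ∀ i, ProjVariety K (r i)) (i : Fin m) : coordVec V i ≠ 0 := by
  obtain ⟨j, hj⟩ := exists_X_notMem_prodIdeal V i
  intro h
  have := congrFun h j
  rw [coordVec, Pi.zero_apply, Polynomial.C_eq_zero] at this
  exact hj (Ideal.Quotient.eq_zero_iff_mem.1 this)

theorem reesMap_linForm (F : RatMap V Y) (i : Fin m)
    (c : Fin (r i + 1) → MvPolynomial (Fin (s + 1)) K) :
    reesMap F (linForm i c) = ∑ j, reesCoeff F (c j) * coordVec V i j := by
  simp only [linForm, map_sum, map_mul]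
  refine Finset.sum_congr rfl fun j _ => ?_
  simp only [reesMap, coe_eval₂Hom, eval₂_C, eval₂_X]
  rfl

theorem linForm_mem_reesPart (F : RatMap V Y) (i : Fin m)
    (c : Fin (r i + 1) → MvPolynomial (Fin (s + 1)) K)
    (hc : ∑ j, reesCoeff F (c j) * coordVec V i j = 0) : linForm i c ∈ reesPart F i := by
  refine ⟨?_, isWeightedHomogeneous_linForm i c⟩
  change reesMap F (linForm i c) = 0
  rw [reesMap_linForm, hc]

theorem sum_linCoeff_of_mem_reesPart (F : RatMap V Y) (i : Fin m)
    {h : MvPolynomial (Idx r) (MvPolynomial (Fin (s + 1)) K)} (hh : h ∈ reesPart F i) :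
    ∑ j, reesCoeff F (linCoeff i h j) * coordVec V i j = 0 := by
  rw [← reesMap_linForm, ← eq_linForm_of_isWeightedHomogeneous hh.2]
  exact hh.1

variable {F : RatMap V Y} {i : Fin m} {k : ℕ}
  {h : Fin k → MvPolynomial (Idx r) (MvPolynomial (Fin (s + 1)) K)}

theorem IsMinGenerators.mem (hh : IsMinGenerators F i h) (a : Fin k) : h a ∈ reesPart F i := by
  rw [← hh.span_eq]
  exact Submodule.subset_span ⟨a, rfl⟩

theorem IsMinGenerators.jacobianDual_mulVec (hh : IsMinGenerators F i h) :
    (jacobianDual i h).map (reesCoeff F) *ᵥ coordVec V i = 0 := by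
  ext1 a
  exact sum_linCoeff_of_mem_reesPart F i (hh.mem a)

theorem IsMinGenerators.rankOver_le [IsDomain (prodRing V)] (hF : F.IsDominant)
    (hh : IsMinGenerators F i h) : rankOver Y (jacobianDual i h) ≤ r i := by
  have := Y.isPrime
  refine rank_le_of_map_mulVec_eq_zero (D := Polynomial (prodRing V)) (reesEmb hF)
    (reesEmb_injective hF) _ (coordVec V i) (coordVec_ne_zero V i) ?_
  rw [map_mk_map_reesEmb, hh.jacobianDual_mulVec]

theorem le_rankOver_of_isInverse (hh : IsMinGenerators F i h)
    {G : RatMapTuple Y V} (hG : IsInverse F G) : r i ≤ rankOver Y (jacobianDual i h) := by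
  classical
  have := Y.isPrime
  obtain ⟨a, ha⟩ := G.ne_zero i
  let θ : MvPolynomial (Fin (s + 1)) K →+* FractionRing Y.coordRing :=
    (algebraMap Y.coordRing (FractionRing Y.coordRing)).comp (Ideal.Quotient.mk Y.ideal)
  refine le_rank_of_ker_le_line _ (fun j => θ (G.form i j)) a ?_ ?_
  · intro h0
    have := (map_eq_zero_iff _
      (IsFractionRing.injective Y.coordRing (FractionRing Y.coordRing))).1 h0
    exact ha (Ideal.Quotient.eq_zero_iff_mem.1 this)
  · intro v hv b
    -- A vector killed by the rows of `ψᵢ` is killed by every Rees equation of this multi-degree,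
    -- since the generators span.
    have hspan : ∀ q ∈ reesPart F i, ∑ j, θ (linCoeff i q j) * v j = 0 := by
      intro q hq
      rw [← hh.span_eq] at hq
      induction hq using Submodule.span_induction with
      | mem q hq =>
        obtain ⟨c, rfl⟩ := hq
        exact congrFun hv c
      | zero => simp [linCoeff]
      | add p q _ _ hp hq =>
        rw [← add_zero (0 : FractionRing Y.coordRing)]
        nth_rewrite 1 [← hp]
        rw [← hq, ← Finset.sum_add_distrib]
        simp [linCoeff, add_mul]
      | smul c q _ hq =>
        rw [← mul_zero (θ c), ← hq, Finset.mul_sum]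
        simp [linCoeff, smul_eq_C_mul, mul_assoc]
    have hX : ∀ j, reesCoeff F (G.form i j) = Polynomial.C (Ideal.Quotient.mk (prodIdeal V)
        (aeval F.form (G.form i j))) * Polynomial.X ^ G.deg i :=
      fun j => reesCoeff_of_isHomogeneous F (G.isHomogeneous i j)
    -- This is the form `g_a x_b - g_b x_a`. It is a Rees equation because `G ∘ F` is the identity,
    -- and at `v` it says `g_a v_b = g_b v_a`.
    have key := hspan (linForm i (Pi.single b (G.form i a) - Pi.single a (G.form i b))) ?_
    · simp only [linCoeff_linForm, Pi.sub_apply, map_sub, sub_mul, Finset.sum_sub_distrib] at key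
      simpa [Pi.single_apply, apply_ite θ, ite_mul, sub_eq_zero] using key
    · refine linForm_mem_reesPart F i _ ?_
      have h1 : ∑ j, reesCoeff F ((Pi.single b (G.form i a) - Pi.single a (G.form i b) :
          Fin (r i + 1) → MvPolynomial (Fin (s + 1)) K) j) * coordVec V i j =
          reesCoeff F (G.form i a) * coordVec V i b -
            reesCoeff F (G.form i b) * coordVec V i a := by
        simp [sub_mul, Finset.sum_sub_distrib, Pi.single_apply, apply_ite (reesCoeff F), ite_mul]
      have h2 := Ideal.Quotient.eq_zero_iff_mem.2 ((hG.1 i).2.2 a b)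
      rw [map_sub, map_mul, map_mul] at h2
      rw [h1, hX, hX, coordVec, coordVec]
      refine (C_mul_X_pow_mul_C_sub _ _ _ _ _).trans ?_
      rw [h2, Polynomial.C_0, zero_mul]

end Rees

/-! ### Constructing the inverse and its uniqueness -/

section Inverse

variable {m : ℕ} {r : Fin m → ℕ} {s : ℕ} {V : ∀ i, ProjVariety K (r i)} {Y : ProjVariety K s}

/-- The monoid homomorphism `d ↦ ∏ cᵢ ^ dᵢ`. -/
def powHom {A : Type*} [CommMonoid A] (c : Fin m → A) : Multiplicative (Fin m → ℕ) →* A where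
  toFun d := ∏ i, c i ^ (d.toAdd i)
  map_one' := by simp
  map_mul' d e := by simp [pow_add, Finset.prod_mul_distrib]

theorem powHom_single {A : Type*} [CommMonoid A] (c : Fin m → A) (i : Fin m) :
    powHom c (Multiplicative.ofAdd (Pi.single i 1)) = c i := by
  change ∏ i', c i' ^ (Pi.single i 1 : Fin m → ℕ) i' = c i
  rw [Finset.prod_eq_single i]
  · simp
  · intro i' _ hne
    rw [Pi.single_eq_of_ne hne, pow_zero]
  · simp

theorem powHom_ne_zero {A : Type*} [CommRing A] [IsDomain A] {c : Fin m → A} (hc : ∀ i, c i ≠ 0)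
    (d : Multiplicative (Fin m → ℕ)) : powHom c d ≠ 0 :=
  show ∏ i, c i ^ (d.toAdd i) ≠ 0 from Finset.prod_ne_zero_iff.2 fun i _ => pow_ne_zero _ (hc i)

/-- Multi-homogeneous polynomials take proportional values at proportional tuples. -/
theorem powHom_mul_aeval_eq {A : Type*} [CommRing A] [Algebra K A] {d : Fin m → ℕ}
    {p : MvPolynomial (Idx r) K} (hp : IsWeightedHomogeneous (xWeight r) p d) (u x : Idx r → A)
    (c e : Fin m → A) (hux : ∀ i j, c i * u ⟨i, j⟩ = e i * x ⟨i, j⟩) :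
    powHom c (Multiplicative.ofAdd d) * aeval u p =
      powHom e (Multiplicative.ofAdd d) * aeval x p := by
  rw [← aeval_mul_of_isWeightedHomogeneous hp, ← aeval_mul_of_isWeightedHomogeneous hp]
  congr 2
  funext t
  rw [xWeight, powHom_single, powHom_single, hux]

theorem pow_mul_aeval_eq {A σ : Type*} [CommRing A] [Algebra K A] {n : ℕ}
    {p : MvPolynomial σ K} (hp : p.IsHomogeneous n) (u x : σ → A) (c e : A)
    (hux : ∀ j, c * u j = e * x j) : c ^ n * aeval u p = e ^ n * aeval x p := by
  have h1 := aeval_mul_of_isWeightedHomogeneous hp (powersHom A c) u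
  have h2 := aeval_mul_of_isWeightedHomogeneous hp (powersHom A e) x
  simp only [Pi.one_apply, powersHom_apply, toAdd_ofAdd, pow_one] at h1 h2
  rw [← h1, ← h2]
  congr 2
  funext j
  exact hux j

/-- Forms on `Y` whose pullbacks under a dominant map `F` are proportional to the coordinates. -/
structure IsInverseForms (F : RatMap V Y)
    (g : ∀ i, Fin (r i + 1) → MvPolynomial (Fin (s + 1)) K) (e : Fin m → ℕ) : Prop where
  isHomogeneous : ∀ i j, (g i j).IsHomogeneous (e i)
  ne_zero : ∀ i, ∃ j, g i j ∉ Y.ideal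
  proportional : ∀ i a b,
    aeval F.form (g i a) * X ⟨i, b⟩ - aeval F.form (g i b) * X ⟨i, a⟩ ∈ prodIdeal V

variable {F : RatMap V Y} {g : ∀ i, Fin (r i + 1) → MvPolynomial (Fin (s + 1)) K}
  {e : Fin m → ℕ}

theorem IsInverseForms.proportional_mk (hg : IsInverseForms F g e) (i : Fin m)
    (a b : Fin (r i + 1)) :
    Ideal.Quotient.mk (prodIdeal V) (X ⟨i, b⟩) *
        Ideal.Quotient.mk (prodIdeal V) (aeval F.form (g i a)) =
      Ideal.Quotient.mk (prodIdeal V) (aeval F.form (g i b)) *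
        Ideal.Quotient.mk (prodIdeal V) (X ⟨i, a⟩) := by
  rw [mul_comm, ← map_mul, ← map_mul]
  exact (Ideal.Quotient.mk_eq_mk_iff_sub_mem _ _).2 (hg.proportional i a b)

/-- By dominance it suffices to check after pullback by `F`. There `g` is proportional to the
coordinates of `Xᵢ`, so for homogeneous `p` a nonzero multiple of the value at `g` equals a multiple
of `p(xᵢ) = 0`. -/
theorem IsInverseForms.maps_to [IsDomain (prodRing V)] (hF : F.IsDominant)
    (hg : IsInverseForms F g e) (i : Fin m) (p : MvPolynomial (Fin (r i + 1)) K)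
    (hp : p ∈ (V i).ideal) : aeval (g i) p ∈ Y.ideal := by
  have key : ∀ n (q : MvPolynomial (Fin (r i + 1)) K), q.IsHomogeneous n → q ∈ (V i).ideal →
      aeval (g i) q ∈ Y.ideal := by
    intro n q hqn hq
    rw [hF.mem_iff (hqn.aeval _ (hg.isHomogeneous i)), ← Ideal.Quotient.eq_zero_iff_mem,
      comp_aeval_apply, ← aeval_mk_eq]
    obtain ⟨b, hb⟩ := exists_X_notMem_prodIdeal V i
    have h1 := pow_mul_aeval_eq hqn _ _ _ _ fun a => hg.proportional_mk i a b
    have h2 : aeval (fun a => Ideal.Quotient.mk (prodIdeal V) (X ⟨i, a⟩)) q = 0 := by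
      rw [aeval_mk_eq, Ideal.Quotient.eq_zero_iff_mem]
      have := rename_mem_prodIdeal V i hq
      rwa [← aeval_X_left_apply (rename (fun j => (⟨i, j⟩ : Idx r)) q), aeval_rename] at this
    rw [h2, mul_zero] at h1
    exact (mul_eq_zero.1 h1).resolve_left
      (pow_ne_zero _ fun h0 => hb (Ideal.Quotient.eq_zero_iff_mem.1 h0))
  rw [← sum_homogeneousComponent p, map_sum]
  exact sum_mem fun n _ => key n _ (homogeneousComponent_isHomogeneous n p)
    (homogeneousComponent_mem_of_mem (V i).isHomogeneous hp n)

/-- The rational map `Y ⇢ X₁ × ⋯ × Xₘ` given by forms as in `IsInverseForms`. -/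
def IsInverseForms.toRatMapTuple [IsDomain (prodRing V)] (hF : F.IsDominant)
    (hg : IsInverseForms F g e) : RatMapTuple Y V where
  form := g
  deg := e
  isHomogeneous := hg.isHomogeneous
  ne_zero := hg.ne_zero
  maps_to := hg.maps_to hF

theorem IsInverseForms.exists_aeval_notMem (hF : F.IsDominant) (hg : IsInverseForms F g e)
    (i : Fin m) : ∃ j, aeval F.form (g i j) ∉ prodIdeal V := by
  obtain ⟨j, hj⟩ := hg.ne_zero i
  exact ⟨j, fun h => hj ((hF.mem_iff (hg.isHomogeneous i j)).2 h)⟩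

theorem isHomogeneous_aeval_sigma {d : Fin m → ℕ}
    {p : MvPolynomial (Idx r) K} (hp : IsWeightedHomogeneous (xWeight r) p d)
    (hg : ∀ i j, (g i j).IsHomogeneous (e i)) :
    (aeval (fun q : Idx r => g q.1 q.2) p).IsHomogeneous (∑ i, d i * e i) := by
  let φ : (Fin m → ℕ) →+ ℕ :=
    { toFun := fun d => ∑ i, d i * e i
      map_zero' := by simp
      map_add' := fun a b => by simp [add_mul, Finset.sum_add_distrib] }
  refine isHomogeneous_aeval_of_isWeightedHomogeneous hp φ _ fun q => ?_
  have : φ (xWeight r q) = e q.1 := by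
    simp [φ, xWeight, Pi.single_apply]
  rw [this]
  exact hg _ _

/-- `G ∘ F` is the identity by proportionality. For `F ∘ G`, multi-homogeneity gives `γ F(G(F)) = γ'
F` in `R` with nonzero `γ`, `γ'`; dominance then carries the proportionality of `F(G(y))` and `y`
back to `Y`. -/
theorem IsInverseForms.isInverse [IsDomain (prodRing V)] (hF : F.IsDominant)
    (hg : IsInverseForms F g e) : IsInverse F (hg.toRatMapTuple hF) := by
  refine ⟨fun i => ⟨hg.exists_aeval_notMem hF i, exists_X_notMem_prodIdeal V i,
    hg.proportional i⟩, ?_⟩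
  -- A fixed nonzero coordinate `x_{i,b i}` of each factor supplies the proportionality constants `c
  -- i` and `c' i`.
  choose b hb using exists_X_notMem_prodIdeal V
  let c : Fin m → prodRing V := fun i => Ideal.Quotient.mk (prodIdeal V) (X ⟨i, b i⟩)
  let c' : Fin m → prodRing V := fun i =>
    Ideal.Quotient.mk (prodIdeal V) (aeval F.form (g i (b i)))
  have hc : ∀ i, c i ≠ 0 := fun i h0 => hb i (Ideal.Quotient.eq_zero_iff_mem.1 h0)
  have hc' : ∀ i, c' i ≠ 0 := by
    intro i h0
    obtain ⟨j, hj⟩ := hg.exists_aeval_notMem hF i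
    have h1 := hg.proportional_mk i j (b i)
    change c i * _ = c' i * _ at h1
    rw [h0, zero_mul] at h1
    exact hj (Ideal.Quotient.eq_zero_iff_mem.1 ((mul_eq_zero.1 h1).resolve_left (hc i)))
  let γ : prodRing V := powHom c (Multiplicative.ofAdd F.deg)
  let γ' : prodRing V := powHom c' (Multiplicative.ofAdd F.deg)
  have hγ : γ ≠ 0 := powHom_ne_zero hc _
  have hγ' : γ' ≠ 0 := powHom_ne_zero hc' _
  have hform : ∀ j, γ * Ideal.Quotient.mk (prodIdeal V)
      (aeval F.form (aeval (fun p : Idx r => g p.1 p.2) (F.form j))) =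
      γ' * Ideal.Quotient.mk (prodIdeal V) (F.form j) := by
    intro j
    have h1 := powHom_mul_aeval_eq (F.isHomogeneous j)
      (fun p => Ideal.Quotient.mk (prodIdeal V) (aeval F.form (g p.1 p.2)))
      (fun p => Ideal.Quotient.mk (prodIdeal V) (X p)) c c'
      fun i a => hg.proportional_mk i a (b i)
    rw [aeval_mk_eq, aeval_mk_eq, aeval_X_left_apply] at h1
    rw [comp_aeval_apply]
    exact h1
  refine ⟨?_, Y.relevant, fun a a' => ?_⟩
  · obtain ⟨j, hj⟩ := F.ne_zero
    refine ⟨j, fun hmem => ?_⟩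
    change aeval (fun p : Idx r => g p.1 p.2) (F.form j) ∈ Y.ideal at hmem
    have h1 := hform j
    rw [Ideal.Quotient.eq_zero_iff_mem.2 (F.maps_to _ hmem), mul_zero] at h1
    exact hj (Ideal.Quotient.eq_zero_iff_mem.1 ((mul_eq_zero.1 h1.symm).resolve_left hγ'))
  · have hhom : ∀ a, (aeval (fun p : Idx r => g p.1 p.2) (F.form a)).IsHomogeneous
        (∑ i, F.deg i * e i) :=
      fun a => isHomogeneous_aeval_sigma (F.isHomogeneous a) hg.isHomogeneous
    refine (hF.mem_iff (((hhom a).mul (isHomogeneous_X K a')).sub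
      ((hhom a').mul (isHomogeneous_X K a)))).2 ?_
    rw [← Ideal.Quotient.eq_zero_iff_mem, map_sub, map_mul, map_mul, aeval_X, aeval_X, map_sub,
      map_mul, map_mul]
    refine (mul_eq_zero.1 (?_ : γ * _ = 0)).resolve_left hγ
    rw [mul_sub, ← mul_assoc, ← mul_assoc, hform, hform]
    ring

theorem IsInverse.isInverseForms {G : RatMapTuple Y V} (hG : IsInverse F G) :
    IsInverseForms F G.form G.deg :=
  ⟨G.isHomogeneous, G.ne_zero, fun i => (hG.1 i).2.2⟩

/-- Both pullbacks are proportional to the same coordinates; multiplying by the square of a nonzero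
coordinate makes the cross products cancel, and dominance descends this to `Y`. -/
theorem IsInverse.same [IsDomain (prodRing V)] (hF : F.IsDominant) {G G' : RatMapTuple Y V}
    (hG : IsInverse F G) (hG' : IsInverse F G') : G'.Same G := by
  refine fun i => ⟨G'.ne_zero i, G.ne_zero i, fun a b => ?_⟩
  refine (hF.mem_iff (((G'.isHomogeneous i a).mul (G.isHomogeneous i b)).sub
    ((G'.isHomogeneous i b).mul (G.isHomogeneous i a)))).2 ?_
  obtain ⟨c, hc⟩ := exists_X_notMem_prodIdeal V i
  have hc0 : Ideal.Quotient.mk (prodIdeal V) (X ⟨i, c⟩) ≠ 0 :=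
    fun h0 => hc (Ideal.Quotient.eq_zero_iff_mem.1 h0)
  rw [← Ideal.Quotient.eq_zero_iff_mem, map_sub, map_mul, map_mul, map_sub, map_mul, map_mul]
  refine (mul_eq_zero.1 ?_).resolve_left (mul_ne_zero hc0 hc0)
  have ha := hG.isInverseForms.proportional_mk i a c
  have hb := hG.isInverseForms.proportional_mk i b c
  have ha' := hG'.isInverseForms.proportional_mk i a c
  have hb' := hG'.isInverseForms.proportional_mk i b c
  generalize Ideal.Quotient.mk (prodIdeal V) (X ⟨i, c⟩) = x at *
  linear_combination (x * Ideal.Quotient.mk (prodIdeal V) (aeval F.form (G.form i b))) * ha' +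
    (Ideal.Quotient.mk (prodIdeal V) (aeval F.form (G'.form i c)) *
      Ideal.Quotient.mk (prodIdeal V) (X ⟨i, a⟩)) * hb -
    (x * Ideal.Quotient.mk (prodIdeal V) (aeval F.form (G.form i a))) * hb' -
    (Ideal.Quotient.mk (prodIdeal V) (aeval F.form (G'.form i c)) *
      Ideal.Quotient.mk (prodIdeal V) (X ⟨i, b⟩)) * ha

theorem IsMinGenerators.isHomogeneous_jacobianDual {i : Fin m} {k : ℕ}
    {h : Fin k → MvPolynomial (Idx r) (MvPolynomial (Fin (s + 1)) K)}
    (hh : IsMinGenerators F i h) :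
    ∃ e : Fin k → ℕ, ∀ a j, (jacobianDual i h a j).IsHomogeneous (e a) := by
  choose e he using hh.isHomogeneous
  refine ⟨e, fun a j => ?_⟩
  change (linCoeff i (h a) j).IsHomogeneous (e a)
  rw [linCoeff_eq_coeff]
  exact he a _

theorem exists_signedMinors_notMem {n : ℕ}
    (M : Matrix (Fin n) (Fin (n + 1)) (MvPolynomial (Fin (s + 1)) K))
    (hM : rankOver Y M = n) : ∃ j, signedMinors M j ∉ Y.ideal := by
  have := Y.isPrime
  obtain ⟨j, hj⟩ := exists_signedMinors_ne_zero _ hM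
  rw [← map_signedMinors] at hj
  exact ⟨j, fun h0 => hj (Ideal.Quotient.eq_zero_iff_mem.2 h0)⟩

theorem signedMinors_proportional_coord [IsDomain (prodRing V)] {i : Fin m}
    (M : Matrix (Fin (r i)) (Fin (r i + 1)) (MvPolynomial (Fin (s + 1)) K)) {d : ℕ}
    (hd : ∀ j, (signedMinors M j).IsHomogeneous d)
    (hM : M.map (reesCoeff F) *ᵥ coordVec V i = 0) (a b : Fin (r i + 1)) :
    aeval F.form (signedMinors M a) * X ⟨i, b⟩ - aeval F.form (signedMinors M b) * X ⟨i, a⟩ ∈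
      prodIdeal V := by
  have h1 := signedMinors_proportional _ _ hM a b
  rw [← map_signedMinors, ← map_signedMinors, reesCoeff_of_isHomogeneous F (hd a),
    reesCoeff_of_isHomogeneous F (hd b), coordVec, coordVec] at h1
  -- All the minors have the same degree `d`, so the factor `t ^ d` is common and can be cancelled,
  -- leaving a relation in `R`.
  have h2 := (C_mul_X_pow_mul_C_sub _ _ _ _ _).symm.trans h1
  have h3 := (mul_eq_zero.1 h2).resolve_right (pow_ne_zero _ Polynomial.X_ne_zero)
  rw [Polynomial.C_eq_zero] at h3
  rw [← Ideal.Quotient.eq_zero_iff_mem, map_sub, map_mul, map_mul]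
  exact h3

theorem exists_isInverseForms_signedMinors [IsDomain (prodRing V)] {k : Fin m → ℕ}
    {h : ∀ i, Fin (k i) → MvPolynomial (Idx r) (MvPolynomial (Fin (s + 1)) K)}
    (hh : ∀ i, IsMinGenerators F i (h i)) (ρ : ∀ i, Fin (r i) ↪o Fin (k i))
    (hρ : ∀ i, rankOver Y ((jacobianDual i (h i)).submatrix (ρ i) id) = r i) :
    ∃ e, IsInverseForms F
      (fun i => signedMinors ((jacobianDual i (h i)).submatrix (ρ i) id)) e := by
  choose ε hε using fun i => (hh i).isHomogeneous_jacobianDual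
  have hd := fun i j => isHomogeneous_signedMinors
    ((jacobianDual i (h i)).submatrix (ρ i) id) (fun a => ε i (ρ i a))
    (fun a j => hε i (ρ i a) j) j
  refine ⟨fun i => ∑ a, ε i (ρ i a), hd, fun i => exists_signedMinors_notMem _ (hρ i),
    fun i => signedMinors_proportional_coord _ (hd i) ?_⟩
  ext1 a
  exact congrFun (hh i).jacobianDual_mulVec (ρ i a)

theorem exists_submatrix_rankOver_eq {k n : ℕ} {β : Type*} [Fintype β]
    (A : Matrix (Fin k) β (MvPolynomial (Fin (s + 1)) K)) (hA : rankOver Y A = n) :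
    ∃ ρ : Fin n ↪o Fin k, rankOver Y (A.submatrix ρ id) = n := by
  have := Y.isPrime
  exact exists_submatrix_rank_eq (A.map (Ideal.Quotient.mk Y.ideal)) hA

theorem rankOver_fullJacobianDual {k : Fin m → ℕ}
    (h : ∀ i, Fin (k i) → MvPolynomial (Idx r) (MvPolynomial (Fin (s + 1)) K)) :
    rankOver Y (fullJacobianDual h) = ∑ i, rankOver Y (jacobianDual i (h i)) := by
  have := Y.isPrime
  have h1 : (fullJacobianDual h).map (Ideal.Quotient.mk Y.ideal) =
      blockDiagonal' fun i => (jacobianDual i (h i)).map (Ideal.Quotient.mk Y.ideal) :=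
    blockDiagonal'_map _ _ (map_zero (Ideal.Quotient.mk Y.ideal))
  have h2 := rank_blockDiagonal' fun i =>
    (jacobianDual i (h i)).map (Ideal.Quotient.mk Y.ideal)
  exact (congrArg Matrix.rank h1).trans h2

end Inverse

end MultiRat

end

/-! ### The criterion -/

theorem mainTheorem9 {K : Type*} [Field K] {m s : ℕ} {r : Fin m → ℕ}
    (V : ∀ i, MultiRat.ProjVariety K (r i)) (Y : MultiRat.ProjVariety K s)
    (hV : IsDomain (MultiRat.prodRing V))
    (F : MultiRat.RatMap V Y) (hF : F.IsDominant)
    (k : Fin m → ℕ)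
    (h : ∀ i, Fin (k i) → MvPolynomial (MultiRat.Idx r) (MvPolynomial (Fin (s + 1)) K))
    (hh : ∀ i, MultiRat.IsMinGenerators F i (h i)) :
    [F.IsBirational,
      ∀ i, MultiRat.rankOver Y (MultiRat.jacobianDual i (h i)) = r i,
      MultiRat.rankOver Y (MultiRat.fullJacobianDual h) = ∑ i, r i].TFAE ∧
    (F.IsBirational →
      (∀ i, ∃ ρ : Fin (r i) ↪o Fin (k i),
        MultiRat.rankOver Y ((MultiRat.jacobianDual i (h i)).submatrix ρ id) = r i) ∧
      ∀ ρ : ∀ i, Fin (r i) ↪o Fin (k i),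
        (∀ i, MultiRat.rankOver Y ((MultiRat.jacobianDual i (h i)).submatrix (ρ i) id) = r i) →
        ∃ G : MultiRat.RatMapTuple Y V,
          (∀ i, G.form i =
            MultiRat.signedMinors ((MultiRat.jacobianDual i (h i)).submatrix (ρ i) id)) ∧
          MultiRat.IsInverse F G ∧
          ∀ G' : MultiRat.RatMapTuple Y V, MultiRat.IsInverse F G' → G'.Same G) := by
  have hle := fun i => (hh i).rankOver_le hF
  have h12 : F.IsBirational →
      ∀ i, MultiRat.rankOver Y (MultiRat.jacobianDual i (h i)) = r i :=
    fun ⟨_, _, hG⟩ i => le_antisymm (hle i) (MultiRat.le_rankOver_of_isInverse (hh i) hG)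
  refine ⟨?_, fun hbir => ⟨fun i => MultiRat.exists_submatrix_rankOver_eq _ (h12 hbir i),
    fun ρ hρ => ?_⟩⟩
  · tfae_have 1 → 2 := h12
    tfae_have 2 → 1 := by
      intro h2
      choose ρ hρ using fun i => MultiRat.exists_submatrix_rankOver_eq _ (h2 i)
      obtain ⟨e, he⟩ := MultiRat.exists_isInverseForms_signedMinors hh ρ hρ
      exact ⟨hF, he.toRatMapTuple hF, he.isInverse hF⟩
    tfae_have 2 ↔ 3 := by
      -- Each block has rank at most `rᵢ`, so equality of the sums forces equality term by term.
      rw [MultiRat.rankOver_fullJacobianDual, Finset.sum_eq_sum_iff_of_le fun i _ => hle i]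
      simp
    tfae_finish
  · obtain ⟨e, he⟩ := MultiRat.exists_isInverseForms_signedMinors hh ρ hρ
    exact ⟨he.toRatMapTuple hF, fun _ => rfl, he.isInverse hF,
      fun G' hG' => (he.isInverse hF).same hF hG'⟩
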